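/- Let $\mathbb{C}[\mathbf{x}]=\mathbb{C}[x_1,\dots,x_n]$ and fix a monomial order $\succ$ on it. For new variables $\mathbf{s}=(s_1,\dots,s_r)$ together with a monomial order $\succ$ on $\mathbb{C}[\mathbf{s}]$, extend $\succ$ to $\mathbb{C}[\mathbf{s},\mathbf{x}]$ by $\mathbf{s}^{\alpha}\mathbf{x}^{a}\succ\mathbf{s}^{\beta}\mathbf{x}^{b}$ if and only if $\alpha\succ\beta$, or $\alpha=\beta$ and $a\succ b$. For a $\mathbb{C}$-subalgebra $S$ of such a polynomial ring, let $S_{\mathrm{in}}=\operatorname{span}_{\mathbb{C}}\{\mathrm{LT}(f)\mid f\in S\}$ be its initial algebra. A subset $G\subseteq S$ is called a Khovanskii basis of $S$ if the leading terms of the elements of $G$ generate $S_{\mathrm{in}}$ as a $\mathbb{C}$-algebra. **Theorem (Decoupling Theorem).** Let $\mathcal{A}\subset\mathbb{C}[\mathbf{x}]$ contain a nonzero constant. Suppose that $\mathcal{A}=\bigcup_{i=1}^{d}\mathcal{B}_i$, where for $i\neq j$ no variable occurs both in a polynomial of $\mathcal{B}_i$ and in a polynomial of $\mathcal{B}_j$,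 and where each $\mathcal{B}_i$ contains a nonzero constant. Suppose that for each $i=1,\dots,d$ the set $G_i:=\{s_ih\mid h\in\mathcal{B}_i\}\subset\mathbb{C}[s_1,\dots,s_d,\mathbf{x}]$ is a Khovanskii basis of the subalgebra it generates. Then $G:=\{sh\mid h\in\mathcal{A}\}\subset\mathbb{C}[s,\mathbf{x}]$, where $s$ is a single new variable, is a Khovanskii basis of the subalgebra it generates. -/

import Mathlib

namespace Decoupling

noncomputable section

open MvPolynomial

/-- The extension of a monomial order `m` on the variables `x` (indexed by `σ`) and a monomial
order `ms` on the variables `s` (indexed by `ι`) to the variables `(s, x)` (indexed by `ι ⊕ σ`):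
`s^α x^a ≻ s^β x^b` iff `α ≻ β`, or `α = β` and `a ≻ b`; see `extendOrder_lt_iff`. -/
def extendOrder {ι σ : Type*} (ms : MonomialOrder ι) (m : MonomialOrder σ) :
    MonomialOrder (ι ⊕ σ) where
  syn := ms.syn ×ₗ m.syn
  wellFoundedLT_syn :=
    ⟨(WellFounded.prod_lex (wellFounded_lt (α := ms.syn)) (wellFounded_lt (α := m.syn))).mono
      fun _ _ h => Prod.lex_iff.mpr (Prod.Lex.lt_iff.mp h)⟩
  toSyn :=
    { toFun := fun c => toLex (ms.toSyn (Finsupp.sumFinsuppAddEquivProdFinsupp c).1,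
        m.toSyn (Finsupp.sumFinsuppAddEquivProdFinsupp c).2)
      invFun := fun p => Finsupp.sumFinsuppAddEquivProdFinsupp.symm
        (ms.toSyn.symm (ofLex p).1, m.toSyn.symm (ofLex p).2)
      left_inv := fun c => by simp
      right_inv := fun p => by simp
      map_add' := fun a b => by
        simp only [map_add, Prod.fst_add, Prod.snd_add, ← toLex_add, Prod.mk_add_mk] }
  toSyn_monotone := fun a b h => by
    apply Prod.Lex.toLex_mono
    exact ⟨ms.toSyn_monotone fun i => h (Sum.inl i), m.toSyn_monotone fun i => h (Sum.inr i)⟩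

/-- `extendOrder` is the lexicographic combination, with the variables `s` compared first. -/
theorem extendOrder_lt_iff {ι σ : Type*} (ms : MonomialOrder ι) (m : MonomialOrder σ)
    (α β : ι →₀ ℕ) (a b : σ →₀ ℕ) :
    (extendOrder ms m).toSyn (Finsupp.sumElim β b) < (extendOrder ms m).toSyn (Finsupp.sumElim α a)
      ↔ ms.toSyn β < ms.toSyn α ∨ (β = α ∧ m.toSyn b < m.toSyn a) := by
  have key : ∀ (γ : ι →₀ ℕ) (c : σ →₀ ℕ), (extendOrder ms m).toSyn (Finsupp.sumElim γ c) =
      toLex (ms.toSyn γ, m.toSyn c) := by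
    intro γ c
    have h : Finsupp.sumFinsuppAddEquivProdFinsupp (Finsupp.sumElim γ c) = (γ, c) := by
      ext i <;> simp
    change toLex (ms.toSyn (Finsupp.sumFinsuppAddEquivProdFinsupp (Finsupp.sumElim γ c)).1,
      m.toSyn (Finsupp.sumFinsuppAddEquivProdFinsupp (Finsupp.sumElim γ c)).2) = _
    rw [h]
  rw [key, key]
  exact Prod.Lex.toLex_lt_toLex.trans (by simp)

/-- The set `{s_i h | h ∈ B}` in `ℂ[s, x]`, where `s = (s_i)_{i : ι}` and `x = (x_j)_{j : σ}`. -/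
def scaledSet {ι σ : Type*} (i : ι) (B : Set (MvPolynomial σ ℂ)) :
    Set (MvPolynomial (ι ⊕ σ) ℂ) :=
  (fun h => X (Sum.inl i) * rename Sum.inr h) '' B

/-- The initial algebra of a subalgebra `S`: the span of the leading terms of all elements of `S`.
-/
def initialAlgebra {τ : Type*} (M : MonomialOrder τ) (S : Subalgebra ℂ (MvPolynomial τ ℂ)) :
    Submodule ℂ (MvPolynomial τ ℂ) :=
  Submodule.span ℂ {t | ∃ f ∈ S, t = M.leadingTerm f}

/-- `G ⊆ S` is a Khovanskii basis of `S` if the algebra generated by the leading terms of the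
elements of `G` is the initial algebra of `S`. -/
def IsKhovanskiiBasis {τ : Type*} (M : MonomialOrder τ) (S : Subalgebra ℂ (MvPolynomial τ ℂ))
    (G : Set (MvPolynomial τ ℂ)) : Prop :=
  G ⊆ (S : Set (MvPolynomial τ ℂ)) ∧
    Subalgebra.toSubmodule (Algebra.adjoin ℂ (M.leadingTerm '' G)) = initialAlgebra M S

end

end Decoupling

open MvPolynomial

open scoped Pointwise

namespace Decoupling

/-! The powers of `s` record a filtration of each block by the number of factors. A constant in `B
i` makes `span (B i ^ k)` increase with `k`, and the Khovanskii hypothesis says that every leading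
exponent in this span is already that of a product in `B i ^ k`
(`exists_degree_eq_of_mem_span_pow`). For each leading exponent `a` of block `i`, fix a product `p i
a` with the least possible number `w i a` of factors. Those with `w i a ≤ k` then span `span (B i ^
k)` (`span_pow_le_span_representatives`).

Hence the elements `s^k ∏ p i (a i)` with `∑ w i (a i) ≤ k` span the algebra generated by `G`
(`adjoin_le_span_blockProduct`). Since the blocks share no variables, `∑ a i` determines every `a
i`, so these elements have distinct leading exponents (`injOn_degree_blockProduct`) and no top terms
cancel in a linear combination. Each leading term of the algebra is thus a multiple of that of some
`s^k ∏ p i (a i)`, which up to a scalar is a product of elements of `G`. -/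

/-! ### Leading terms, products of generators, and initial algebras. -/

/-- The leading term as a monoid homomorphism. -/
noncomputable def leadingTermHom {τ : Type*} (M : MonomialOrder τ) :
    MvPolynomial τ ℂ →* MvPolynomial τ ℂ where
  toFun := M.leadingTerm
  map_one' := by simpa using M.leadingTerm_C (1 : ℂ)
  map_mul' := M.leadingTerm_mul

theorem leadingTermHom_apply {τ : Type*} (M : MonomialOrder τ) (f : MvPolynomial τ ℂ) :
    leadingTermHom M f = M.leadingTerm f := rfl

theorem toSubmodule_adjoin_leadingTerm {τ : Type*} (M : MonomialOrder τ)
    (G : Set (MvPolynomial τ ℂ)) :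
    Subalgebra.toSubmodule (Algebra.adjoin ℂ (M.leadingTerm '' G)) =
      Submodule.span ℂ (M.leadingTerm '' (Submonoid.closure G : Set (MvPolynomial τ ℂ))) := by
  rw [Algebra.adjoin_eq_span]
  congr 1
  have h := MonoidHom.map_mclosure (leadingTermHom M) G
  exact (congrArg (fun S : Submonoid (MvPolynomial τ ℂ) => (S : Set (MvPolynomial τ ℂ))) h).symm

theorem leadingTerm_mem_adjoin {τ : Type*} (M : MonomialOrder τ)
    {G : Set (MvPolynomial τ ℂ)} {g : MvPolynomial τ ℂ} (hg : g ∈ Submonoid.closure G) :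
    M.leadingTerm g ∈ Algebra.adjoin ℂ (M.leadingTerm '' G) := by
  rw [← Subalgebra.mem_toSubmodule, toSubmodule_adjoin_leadingTerm]
  exact Submodule.subset_span ⟨g, hg, rfl⟩

theorem closure_le_adjoin {R : Type*} [CommRing R] [Algebra ℂ R] (G : Set R) :
    Submonoid.closure G ≤ (Algebra.adjoin ℂ G).toSubsemiring.toSubmonoid :=
  Submonoid.closure_le.mpr Algebra.subset_adjoin

theorem adjoin_leadingTerm_le_initialAlgebra {τ : Type*} (M : MonomialOrder τ)
    (G : Set (MvPolynomial τ ℂ)) :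
    Subalgebra.toSubmodule (Algebra.adjoin ℂ (M.leadingTerm '' G)) ≤
      initialAlgebra M (Algebra.adjoin ℂ G) := by
  rw [toSubmodule_adjoin_leadingTerm]
  refine Submodule.span_mono ?_
  rintro _ ⟨g, hg, rfl⟩
  exact ⟨g, closure_le_adjoin G hg, rfl⟩

theorem leadingTerm_eq_smul_of_degree_eq {τ : Type*} (M : MonomialOrder τ)
    {f g : MvPolynomial τ ℂ} (hg : g ≠ 0) (h : M.degree f = M.degree g) :
    M.leadingTerm f = (M.leadingCoeff f / M.leadingCoeff g) • M.leadingTerm g := by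
  have : M.leadingCoeff g ≠ 0 := M.leadingCoeff_ne_zero_iff.mpr hg
  simp only [MonomialOrder.leadingTerm, h, smul_monomial, smul_eq_mul]
  field_simp

/-- If `G` is a Khovanskii basis, every leading exponent is that of a product of elements of `G`. -/
theorem IsKhovanskiiBasis.exists_degree_eq {τ : Type*} {M : MonomialOrder τ}
    {G : Set (MvPolynomial τ ℂ)} (hK : IsKhovanskiiBasis M (Algebra.adjoin ℂ G) G)
    {f : MvPolynomial τ ℂ} (hf : f ∈ Algebra.adjoin ℂ G) (hf0 : f ≠ 0) :
    ∃ g ∈ Submonoid.closure G, g ≠ 0 ∧ M.degree g = M.degree f := by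
  classical
  by_contra! hne
  have h1 : M.leadingTerm f ∈ initialAlgebra M (Algebra.adjoin ℂ G) :=
    Submodule.subset_span ⟨f, hf, rfl⟩
  rw [← hK.2, toSubmodule_adjoin_leadingTerm] at h1
  -- Reading off the coefficient at the leading exponent of `f` kills every leading term in this
  -- span, but not that of `f`.
  have h2 : Submodule.span ℂ
      (M.leadingTerm '' (Submonoid.closure G : Set (MvPolynomial τ ℂ))) ≤
      LinearMap.ker (lcoeff ℂ (M.degree f)) := by
    rw [Submodule.span_le]
    rintro _ ⟨g, hg, rfl⟩
    rw [SetLike.mem_coe, LinearMap.mem_ker, lcoeff_apply]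
    by_cases hg0 : g = 0
    · simp [hg0]
    · rw [MonomialOrder.leadingTerm, coeff_monomial, if_neg (hne g hg hg0)]
  have h3 := h2 h1
  rw [LinearMap.mem_ker, lcoeff_apply, MonomialOrder.leadingTerm, coeff_monomial, if_pos rfl] at h3
  exact hf0 (M.leadingCoeff_eq_zero_iff.mp h3)

/-- Leading terms with distinct exponents cannot cancel, so the largest one that occurs survives. -/
theorem exists_degree_eq_of_sum_ne_zero {τ κ : Type*} (M : MonomialOrder τ)
    (t : κ → MvPolynomial τ ℂ) (c : κ → ℂ) (S : Finset κ)
    (hinj : Set.InjOn (fun i => M.degree (t i)) S)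
    (hsum : ∑ i ∈ S, c i • t i ≠ 0) :
    ∃ i ∈ S, t i ≠ 0 ∧ M.degree (∑ i ∈ S, c i • t i) = M.degree (t i) := by
  classical
  induction S using Finset.induction_on with
  | empty => simp at hsum
  | insert a S ha ih =>
    rw [Finset.sum_insert ha] at hsum ⊢
    have hinj' : Set.InjOn (fun i => M.degree (t i)) S :=
      hinj.mono (by simp)
    by_cases h1 : c a • t a = 0
    · rw [h1, zero_add] at hsum ⊢
      obtain ⟨i, hi, h⟩ := ih hinj' hsum
      exact ⟨i, Finset.mem_insert_of_mem hi, h⟩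
    have hca : c a ≠ 0 := fun h => h1 (by simp [h])
    have hta : t a ≠ 0 := fun h => h1 (by simp [h])
    have hda : M.degree (c a • t a) = M.degree (t a) :=
      M.degree_smul_of_isRegular (IsRegular.of_ne_zero hca)
    by_cases h2 : ∑ i ∈ S, c i • t i = 0
    · rw [h2, add_zero]
      exact ⟨a, Finset.mem_insert_self _ _, hta, hda⟩
    obtain ⟨i, hi, hti, hdi⟩ := ih hinj' h2
    have hne : M.degree (t a) ≠ M.degree (t i) := fun h => ha <| by
      rw [hinj (by simp) (by simp [hi]) h]
      exact hi
    rcases lt_trichotomy (M.toSyn (M.degree (t a))) (M.toSyn (M.degree (t i))) with h | h | h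
    · refine ⟨i, Finset.mem_insert_of_mem hi, hti, ?_⟩
      rw [M.degree_add_eq_right_of_lt (by rwa [hda, hdi]), hdi]
    · exact absurd (M.toSyn.injective h) hne
    · refine ⟨a, Finset.mem_insert_self _ _, hta, ?_⟩
      rw [M.degree_add_of_lt (by rwa [hda, hdi]), hda]

theorem exists_degree_eq_of_mem_span {τ κ : Type*} (M : MonomialOrder τ)
    (t : κ → MvPolynomial τ ℂ) (I : Set κ) (hinj : Set.InjOn (fun i => M.degree (t i)) I)
    {f : MvPolynomial τ ℂ} (hf : f ∈ Submodule.span ℂ (t '' I)) (hf0 : f ≠ 0) :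
    ∃ i ∈ I, t i ≠ 0 ∧ M.degree f = M.degree (t i) := by
  obtain ⟨l, hl, rfl⟩ := (Finsupp.mem_span_image_iff_linearCombination ℂ).mp hf
  rw [Finsupp.mem_supported] at hl
  rw [Finsupp.linearCombination_apply, Finsupp.sum] at hf0 ⊢
  obtain ⟨i, hi, h⟩ := exists_degree_eq_of_sum_ne_zero M t l l.support (hinj.mono hl) hf0
  exact ⟨i, hl hi, h⟩

/-! ### Leading exponents of `s_i ^ k * q` in the extended order. -/

theorem extendOrder_toSyn {ι σ : Type*} (ms : MonomialOrder ι) (m : MonomialOrder σ)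
    (γ : ι →₀ ℕ) (c : σ →₀ ℕ) :
    (extendOrder ms m).toSyn (Finsupp.sumElim γ c) = toLex (ms.toSyn γ, m.toSyn c) := by
  have h : Finsupp.sumFinsuppAddEquivProdFinsupp (Finsupp.sumElim γ c) = (γ, c) := by
    ext i <;> simp
  change toLex (ms.toSyn (Finsupp.sumFinsuppAddEquivProdFinsupp (Finsupp.sumElim γ c)).1,
    m.toSyn (Finsupp.sumFinsuppAddEquivProdFinsupp (Finsupp.sumElim γ c)).2) = _
  rw [h]

theorem mapDomain_inr_eq_sumElim {ι σ : Type*} (a : σ →₀ ℕ) :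
    Finsupp.mapDomain (Sum.inr : σ → ι ⊕ σ) a = Finsupp.sumElim 0 a := by
  ext (i | j)
  · simp [Finsupp.mapDomain_of_notMem_range]
  · simp [Finsupp.mapDomain_apply Sum.inr_injective]

theorem degree_rename_inr {ι σ : Type*} (ms : MonomialOrder ι) (m : MonomialOrder σ)
    (q : MvPolynomial σ ℂ) :
    (extendOrder ms m).degree (rename Sum.inr q) = Finsupp.sumElim 0 (m.degree q) := by
  classical
  by_cases hq : q = 0
  · subst hq
    ext (i | j) <;> simp
  apply (extendOrder ms m).toSyn.injective
  apply le_antisymm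
  · rw [MonomialOrder.degree_le_iff]
    intro b hb
    rw [support_rename_of_injective Sum.inr_injective, Finset.mem_image] at hb
    obtain ⟨a, ha, rfl⟩ := hb
    rw [mapDomain_inr_eq_sumElim, extendOrder_toSyn, extendOrder_toSyn]
    exact Prod.Lex.toLex_mono ⟨le_rfl, m.le_degree ha⟩
  · apply MonomialOrder.le_degree
    rw [support_rename_of_injective Sum.inr_injective, Finset.mem_image]
    exact ⟨m.degree q, m.degree_mem_support hq, mapDomain_inr_eq_sumElim _⟩

/-- The polynomial `s_i ^ k * q`. -/
noncomputable def scale {ι σ : Type*} (i : ι) (k : ℕ) (q : MvPolynomial σ ℂ) :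
    MvPolynomial (ι ⊕ σ) ℂ :=
  X (Sum.inl i) ^ k * rename Sum.inr q

theorem scale_ne_zero {ι σ : Type*} (i : ι) (k : ℕ) {q : MvPolynomial σ ℂ} (hq : q ≠ 0) :
    scale i k q ≠ 0 :=
  mul_ne_zero (pow_ne_zero _ (X_ne_zero _))
    ((map_ne_zero_iff _ (rename_injective _ Sum.inr_injective)).mpr hq)

theorem scale_mul_scale {ι σ : Type*} (i : ι) (k l : ℕ) (p q : MvPolynomial σ ℂ) :
    scale i k p * scale i l q = scale i (k + l) (p * q) := by
  simp only [scale, map_mul, pow_add]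
  ring

theorem degree_scale {ι σ : Type*} (ms : MonomialOrder ι) (m : MonomialOrder σ) (i : ι) (k : ℕ)
    {q : MvPolynomial σ ℂ} (hq : q ≠ 0) :
    (extendOrder ms m).degree (scale i k q) =
      Finsupp.sumElim (Finsupp.single i k) (m.degree q) := by
  classical
  have hX : (X (Sum.inl i) : MvPolynomial (ι ⊕ σ) ℂ) ^ k ≠ 0 := pow_ne_zero _ (X_ne_zero _)
  have hr : rename (Sum.inr : σ → ι ⊕ σ) q ≠ 0 :=
    (map_ne_zero_iff _ (rename_injective _ Sum.inr_injective)).mpr hq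
  rw [scale, MonomialOrder.degree_mul hX hr, degree_rename_inr, MonomialOrder.degree_pow,
    MonomialOrder.degree_X]
  ext (j | j)
  · simp [Finsupp.single_apply]
  · simp

theorem scale_mem_closure {ι σ : Type*} (i : ι) {B : Set (MvPolynomial σ ℂ)} {k : ℕ}
    {q : MvPolynomial σ ℂ} (hq : q ∈ B ^ k) :
    scale i k q ∈ Submonoid.closure (scaledSet i B) := by
  induction k generalizing q with
  | zero =>
    rw [pow_zero, Set.mem_one] at hq
    simp [hq, scale]
  | succ k ih =>
    rw [pow_succ] at hq
    obtain ⟨p, hp, h, hh, rfl⟩ := Set.mem_mul.mp hq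
    rw [← scale_mul_scale]
    refine mul_mem (ih hp) (Submonoid.subset_closure ⟨h, hh, ?_⟩)
    simp [scale]

theorem exists_scale_of_mem_closure {ι σ : Type*} (i : ι) {B : Set (MvPolynomial σ ℂ)}
    {g : MvPolynomial (ι ⊕ σ) ℂ} (hg : g ∈ Submonoid.closure (scaledSet i B)) :
    ∃ k, ∃ q ∈ B ^ k, g = scale i k q := by
  induction hg using Submonoid.closure_induction with
  | mem x hx =>
    obtain ⟨h, hh, rfl⟩ := hx
    exact ⟨1, h, by simpa using hh, by simp [scale]⟩
  | one => exact ⟨0, 1, by simp, by simp [scale]⟩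
  | mul x y _ _ hx hy =>
    obtain ⟨k, p, hp, rfl⟩ := hx
    obtain ⟨l, q, hq, rfl⟩ := hy
    exact ⟨k + l, p * q, by rw [pow_add]; exact Set.mul_mem_mul hp hq, scale_mul_scale ..⟩

/-- `scale` as a linear map. -/
noncomputable def scaleLinear {ι σ : Type*} (i : ι) (k : ℕ) :
    MvPolynomial σ ℂ →ₗ[ℂ] MvPolynomial (ι ⊕ σ) ℂ :=
  LinearMap.mulLeft ℂ (X (Sum.inl i) ^ k) ∘ₗ (rename Sum.inr).toLinearMap

theorem scaleLinear_apply {ι σ : Type*} (i : ι) (k : ℕ) (q : MvPolynomial σ ℂ) :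
    scaleLinear i k q = scale i k q := rfl

/-- The factor `s_i ^ k` carries the number of factors into the leading exponent, so the product
supplied by the Khovanskii property must lie in the same power `B ^ k`. -/
theorem exists_degree_eq_of_mem_span_pow {ι σ : Type*} {ms : MonomialOrder ι}
    {m : MonomialOrder σ} {i : ι} {B : Set (MvPolynomial σ ℂ)}
    (hK : IsKhovanskiiBasis (extendOrder ms m) (Algebra.adjoin ℂ (scaledSet i B)) (scaledSet i B))
    {k : ℕ} {f : MvPolynomial σ ℂ} (hf : f ∈ Submodule.span ℂ (B ^ k)) (hf0 : f ≠ 0) :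
    ∃ q ∈ B ^ k, q ≠ 0 ∧ m.degree q = m.degree f := by
  have hle : Submodule.span ℂ (B ^ k) ≤
      (Subalgebra.toSubmodule (Algebra.adjoin ℂ (scaledSet i B))).comap (scaleLinear i k) := by
    rw [Submodule.span_le]
    intro q hq
    exact closure_le_adjoin _ (scale_mem_closure i hq)
  obtain ⟨g, hg, hg0, hdeg⟩ := hK.exists_degree_eq (hle hf) (scale_ne_zero i k hf0)
  obtain ⟨l, q, hq, rfl⟩ := exists_scale_of_mem_closure i hg
  have hq0 : q ≠ 0 := by
    rintro rfl
    simp [scale] at hg0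
  rw [scaleLinear_apply, degree_scale ms m i l hq0, degree_scale ms m i k hf0] at hdeg
  have hl : l = k := by simpa using DFunLike.congr_fun hdeg (Sum.inl i)
  subst hl
  refine ⟨q, hq, hq0, ?_⟩
  ext j
  simpa using DFunLike.congr_fun hdeg (Sum.inr j)

/-! ### One block: representatives with the fewest factors. -/

/-- The leading exponents of nonzero products of elements of `B`. -/
def powDegrees {σ : Type*} (m : MonomialOrder σ) (B : Set (MvPolynomial σ ℂ)) : Set (σ →₀ ℕ) :=
  {a | ∃ k, ∃ q ∈ B ^ k, q ≠ 0 ∧ m.degree q = a}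

theorem exists_minimal_representatives {σ : Type*} (m : MonomialOrder σ)
    (B : Set (MvPolynomial σ ℂ)) :
    ∃ (w : (σ →₀ ℕ) → ℕ) (p : (σ →₀ ℕ) → MvPolynomial σ ℂ),
      (∀ a ∈ powDegrees m B, p a ∈ B ^ w a ∧ p a ≠ 0 ∧ m.degree (p a) = a) ∧
      ∀ k, ∀ q ∈ B ^ k, q ≠ 0 → w (m.degree q) ≤ k := by
  classical
  have key : ∀ a, ∃ (w : ℕ) (p : MvPolynomial σ ℂ),
      (a ∈ powDegrees m B → p ∈ B ^ w ∧ p ≠ 0 ∧ m.degree p = a) ∧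
      ∀ k, ∀ q ∈ B ^ k, q ≠ 0 → m.degree q = a → w ≤ k := by
    intro a
    by_cases ha : a ∈ powDegrees m B
    · obtain ⟨p, hp⟩ := Nat.find_spec ha
      exact ⟨Nat.find ha, p, fun _ => hp, fun k q h1 h2 h3 => Nat.find_min' ha ⟨q, h1, h2, h3⟩⟩
    · exact ⟨0, 0, fun h => absurd h ha, fun _ _ _ _ _ => Nat.zero_le _⟩
  choose w p h1 h2 using key
  exact ⟨w, p, h1, fun k q hq hq0 => h2 _ k q hq hq0 rfl⟩

/-- Subduction: subtract the multiple of a representative that cancels the leading term, and recurse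
on the well-ordered exponents. The constant in `B` keeps the remainder in `span (B ^ k)`, since the
representative may have fewer than `k` factors. -/
theorem span_pow_le_span_representatives {σ : Type*} (m : MonomialOrder σ)
    {B : Set (MvPolynomial σ ℂ)} (hB : ∃ c : ℂ, c ≠ 0 ∧ C c ∈ B)
    (hdeg : ∀ k, ∀ f ∈ Submodule.span ℂ (B ^ k), f ≠ 0 →
      ∃ q ∈ B ^ k, q ≠ 0 ∧ m.degree q = m.degree f)
    {w : (σ →₀ ℕ) → ℕ} {p : (σ →₀ ℕ) → MvPolynomial σ ℂ}
    (hp : ∀ a ∈ powDegrees m B, p a ∈ B ^ w a ∧ p a ≠ 0 ∧ m.degree (p a) = a)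
    (hw : ∀ k, ∀ q ∈ B ^ k, q ≠ 0 → w (m.degree q) ≤ k) (k : ℕ) :
    Submodule.span ℂ (B ^ k) ≤ Submodule.span ℂ (p '' {a | a ∈ powDegrees m B ∧ w a ≤ k}) := by
  have h1 : (1 : Submodule ℂ (MvPolynomial σ ℂ)) ≤ Submodule.span ℂ B := by
    obtain ⟨c, hc, hcB⟩ := hB
    rw [Submodule.one_le]
    have := Submodule.smul_mem _ c⁻¹ (Submodule.subset_span (R := ℂ) hcB)
    rwa [smul_eq_C_mul, ← C_mul, inv_mul_cancel₀ hc, C_1] at this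
  have hmono : ∀ {l}, l ≤ k → Submodule.span ℂ (B ^ l) ≤ Submodule.span ℂ (B ^ k) := by
    intro l hl
    rw [← Submodule.span_pow, ← Submodule.span_pow]
    exact pow_le_pow_right' h1 hl
  suffices H : ∀ (d : m.syn) (f : MvPolynomial σ ℂ), m.toSyn (m.degree f) = d →
      f ∈ Submodule.span ℂ (B ^ k) →
      f ∈ Submodule.span ℂ (p '' {a | a ∈ powDegrees m B ∧ w a ≤ k}) from
    fun f hf => H _ f rfl hf
  intro d
  induction d using WellFoundedLT.induction with
  | ind d ih =>
    rintro f rfl hf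
    by_cases hf0 : f = 0
    · simp [hf0]
    obtain ⟨q, hq, hq0, hqf⟩ := hdeg k f hf hf0
    have ha : m.degree f ∈ powDegrees m B := ⟨k, q, hq, hq0, hqf⟩
    have hwa : w (m.degree f) ≤ k := hqf ▸ hw k q hq hq0
    obtain ⟨hpB, hp0, hpd⟩ := hp _ ha
    set g := p (m.degree f)
    have hgs : g ∈ Submodule.span ℂ (p '' {a | a ∈ powDegrees m B ∧ w a ≤ k}) :=
      Submodule.subset_span ⟨_, ⟨ha, hwa⟩, rfl⟩
    have hlc : m.leadingCoeff g ≠ 0 := m.leadingCoeff_ne_zero_iff.mpr hp0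
    set c := m.leadingCoeff f / m.leadingCoeff g
    have hfe : f = (f - c • g) + c • g := by ring
    rw [hfe]
    refine add_mem ?_ (Submodule.smul_mem _ _ hgs)
    by_cases hr0 : f - c • g = 0
    · rw [hr0]
      exact zero_mem _
    refine ih _ ?_ _ rfl
      (sub_mem hf (Submodule.smul_mem _ _ (hmono hwa (Submodule.subset_span hpB))))
    have hle : m.toSyn (m.degree (f - c • g)) ≤ m.toSyn (m.degree f) := by
      refine m.degree_sub_le.trans (sup_le le_rfl ?_)
      exact m.degree_smul_le.trans (by rw [hpd])
    -- With equal degrees, the choice of `c` would make the leading coefficient of the nonzero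
    -- remainder vanish.
    refine lt_of_le_of_ne hle fun h => ?_
    have hd := m.toSyn.injective h
    apply m.coeff_degree_ne_zero_iff.mpr hr0
    rw [hd, coeff_sub, coeff_smul, smul_eq_mul]
    have hg' : coeff (m.degree f) g = m.leadingCoeff g := by
      rw [MonomialOrder.leadingCoeff, hpd]
    rw [hg', div_mul_cancel₀ _ hlc]
    exact sub_self _

/-! ### Combining blocks with disjoint variables. -/

theorem exists_mem_vars_of_mem_powDegrees {σ : Type*} {m : MonomialOrder σ}
    {B : Set (MvPolynomial σ ℂ)} {a : σ →₀ ℕ} (ha : a ∈ powDegrees m B) {v : σ} (hv : a v ≠ 0) :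
    ∃ q ∈ B, v ∈ q.vars := by
  classical
  obtain ⟨k, q, hq, hq0, rfl⟩ := ha
  have hvq : v ∈ q.vars :=
    (mem_vars_iff_mem_support v).mpr
      ⟨_, m.degree_mem_support hq0, Finsupp.mem_support_iff.mpr hv⟩
  clear hv hq0
  induction k generalizing q with
  | zero =>
    rw [pow_zero, Set.mem_one] at hq
    simp [hq] at hvq
  | succ k ih =>
    rw [pow_succ] at hq
    obtain ⟨p, hp, h, hh, rfl⟩ := Set.mem_mul.mp hq
    rcases Finset.mem_union.mp (vars_mul p h hvq) with h1 | h1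
    · exact ih p hp h1
    · exact ⟨h, hh, h1⟩

/-- Each variable occurs in at most one block, so each coordinate of the sum comes from a single
summand. -/
theorem eq_of_sum_eq_of_mem_powDegrees {κ σ : Type*} [Fintype κ] {m : MonomialOrder σ}
    {B : κ → Set (MvPolynomial σ ℂ)}
    (hvars : ∀ i j, i ≠ j → ∀ p ∈ B i, ∀ q ∈ B j, Disjoint p.vars q.vars)
    {a b : κ → σ →₀ ℕ} (ha : ∀ i, a i ∈ powDegrees m (B i)) (hb : ∀ i, b i ∈ powDegrees m (B i))
    (hab : ∑ i, a i = ∑ i, b i) : a = b := by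
  have key : ∀ {c : κ → σ →₀ ℕ}, (∀ i, c i ∈ powDegrees m (B i)) → ∀ {i v},
      (∃ q ∈ B i, v ∈ q.vars) → (∑ j, c j) v = c i v := by
    rintro c hc i v ⟨q, hq, hv⟩
    rw [Finsupp.finsetSum_apply]
    refine Finset.sum_eq_single i (fun j _ hj => ?_) (by simp)
    by_contra h0
    obtain ⟨r, hr, hvr⟩ := exists_mem_vars_of_mem_powDegrees (hc j) h0
    exact Finset.disjoint_left.mp (hvars j i hj r hr q hq) hvr hv
  funext i
  ext v
  by_cases h : ∃ q ∈ B i, v ∈ q.vars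
  · rw [← key ha h, ← key hb h, hab]
  · have h0 : ∀ {c : σ →₀ ℕ}, c ∈ powDegrees m (B i) → c v = 0 := fun hc =>
      not_not.mp fun hne => h (exists_mem_vars_of_mem_powDegrees hc hne)
    rw [h0 (ha i), h0 (hb i)]

theorem scale_prod {ι σ κ : Type*} (i : ι) (S : Finset κ) (w : κ → ℕ)
    (q : κ → MvPolynomial σ ℂ) :
    scale i (∑ j ∈ S, w j) (∏ j ∈ S, q j) = ∏ j ∈ S, scale i (w j) (q j) := by
  simp only [scale, map_prod, Finset.prod_mul_distrib, Finset.prod_pow_eq_pow_sum]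

/-- Exponents `k` of `s` together with a leading exponent for each block, whose weights sum to at
most `k`. -/
def blockIndices {κ σ : Type*} [Fintype κ] (m : MonomialOrder σ)
    (B : κ → Set (MvPolynomial σ ℂ)) (w : κ → (σ →₀ ℕ) → ℕ) : Set (ℕ × (κ → σ →₀ ℕ)) :=
  {u | (∀ i, u.2 i ∈ powDegrees m (B i)) ∧ ∑ i, w i (u.2 i) ≤ u.1}

/-- The product over all blocks of chosen representatives of leading exponents, scaled by `s^k`. -/
noncomputable def blockProduct {ι κ σ : Type*} [Fintype κ] (e : ι)
    (p : κ → (σ →₀ ℕ) → MvPolynomial σ ℂ) (u : ℕ × (κ → σ →₀ ℕ)) : MvPolynomial (ι ⊕ σ) ℂ :=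
  scale e u.1 (∏ i, p i (u.2 i))

/-- Only the factor of block `i` changes: `p i (a i) * h` has one more factor, so it re-expands in
representatives of weight at most `w i (a i) + 1`. The total weight grows by at most one, matching
the new power of `s`. -/
theorem blockProduct_mul_scale_mem_span {ι κ σ : Type*} [Fintype κ] (e : ι)
    {m : MonomialOrder σ} {B : κ → Set (MvPolynomial σ ℂ)}
    {w : κ → (σ →₀ ℕ) → ℕ} {p : κ → (σ →₀ ℕ) → MvPolynomial σ ℂ}
    (hp : ∀ i, ∀ a ∈ powDegrees m (B i), p i a ∈ B i ^ w i a)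
    (hspan : ∀ i k, Submodule.span ℂ (B i ^ k) ≤
      Submodule.span ℂ (p i '' {a | a ∈ powDegrees m (B i) ∧ w i a ≤ k}))
    {u : ℕ × (κ → σ →₀ ℕ)} (hu : u ∈ blockIndices m B w) {i : κ} {h : MvPolynomial σ ℂ}
    (hh : h ∈ B i) :
    blockProduct e p u * scale e 1 h ∈ Submodule.span ℂ (blockProduct e p '' blockIndices m B w) := by
  classical
  obtain ⟨k, a⟩ := u
  obtain ⟨ha, hk⟩ := hu
  dsimp only at ha hk
  set r := ∏ j ∈ Finset.univ.erase i, p j (a j)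
  have h1 : p i (a i) * h ∈ Submodule.span ℂ (B i ^ (w i (a i) + 1)) := by
    refine Submodule.subset_span ?_
    rw [pow_succ]
    exact Set.mul_mem_mul (hp i _ (ha i)) hh
  have hle : Submodule.span ℂ (p i '' {b | b ∈ powDegrees m (B i) ∧ w i b ≤ w i (a i) + 1}) ≤
      (Submodule.span ℂ (blockProduct e p '' blockIndices m B w)).comap
        (scaleLinear e (k + 1) ∘ₗ LinearMap.mulRight ℂ r) := by
    rw [Submodule.span_le]
    rintro _ ⟨b, ⟨hb, hwb⟩, rfl⟩
    refine Submodule.subset_span ⟨(k + 1, Function.update a i b), ⟨fun j => ?_, ?_⟩, ?_⟩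
    · by_cases hj : j = i
      · subst hj
        simpa using hb
      · simpa [hj] using ha j
    · rw [← Finset.add_sum_erase _ _ (Finset.mem_univ i)] at hk ⊢
      have : ∑ j ∈ Finset.univ.erase i, w j (Function.update a i b j) =
          ∑ j ∈ Finset.univ.erase i, w j (a j) :=
        Finset.sum_congr rfl fun j hj => by
          rw [Function.update_of_ne (Finset.ne_of_mem_erase hj)]
      simp only [this, Function.update_self]
      omega
    · have : ∏ j ∈ Finset.univ.erase i, p j (Function.update a i b j) = r :=
        Finset.prod_congr rfl fun j hj => by
          rw [Function.update_of_ne (Finset.ne_of_mem_erase hj)]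
      simp only [blockProduct]
      rw [← Finset.mul_prod_erase _ _ (Finset.mem_univ i), this, Function.update_self]
      rfl
  have h2 := hle (hspan i _ h1)
  rw [Submodule.mem_comap] at h2
  convert h2 using 1
  simp only [blockProduct]
  rw [scale_mul_scale, ← Finset.mul_prod_erase _ _ (Finset.mem_univ i)]
  change scale e (k + 1) (p i (a i) * r * h) = scale e (k + 1) (p i (a i) * h * r)
  congr 1
  ring

theorem adjoin_le_span_blockProduct {ι κ σ : Type*} [Fintype κ] (e : ι)
    {m : MonomialOrder σ} {B : κ → Set (MvPolynomial σ ℂ)}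
    {w : κ → (σ →₀ ℕ) → ℕ} {p : κ → (σ →₀ ℕ) → MvPolynomial σ ℂ}
    (hp : ∀ i, ∀ a ∈ powDegrees m (B i), p i a ∈ B i ^ w i a)
    (hw : ∀ i, ∀ k, ∀ q ∈ B i ^ k, q ≠ 0 → w i (m.degree q) ≤ k)
    (hspan : ∀ i k, Submodule.span ℂ (B i ^ k) ≤
      Submodule.span ℂ (p i '' {a | a ∈ powDegrees m (B i) ∧ w i a ≤ k})) :
    Subalgebra.toSubmodule (Algebra.adjoin ℂ (scaledSet e (⋃ i, B i))) ≤
      Submodule.span ℂ (blockProduct e p '' blockIndices m B w) := by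
  rw [Algebra.adjoin_eq_span, Submodule.span_le]
  intro g hg
  induction hg using Submonoid.closure_induction_right with
  | one =>
    have hz : ∀ i, (0 : σ →₀ ℕ) ∈ powDegrees m (B i) := fun i =>
      ⟨0, 1, by simp, one_ne_zero, m.degree_one⟩
    -- The empty product has exponent `0`, so weight `0` is minimal; then `p i 0` lies in `B i ^ 0 =
    -- {1}`.
    have hwz : ∀ i, w i 0 = 0 := fun i => by
      have := hw i 0 1 (by simp) one_ne_zero
      rw [m.degree_one] at this
      omega
    refine Submodule.subset_span ⟨(0, fun _ => 0), ⟨hz, by simp [hwz]⟩, ?_⟩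
    have hpz : ∀ i, p i 0 = 1 := fun i => by
      have := hp i 0 (hz i)
      rwa [hwz, pow_zero, Set.mem_one] at this
    simp [blockProduct, scale, hpz]
  | mul_right x _ y hy hx =>
    obtain ⟨h, hh, rfl⟩ := hy
    obtain ⟨i, hi⟩ := Set.mem_iUnion.mp hh
    have hle : Submodule.span ℂ (blockProduct e p '' blockIndices m B w) ≤
        (Submodule.span ℂ (blockProduct e p '' blockIndices m B w)).comap
          (LinearMap.mulRight ℂ (scale e 1 h)) := by
      rw [Submodule.span_le]
      rintro _ ⟨u, hu, rfl⟩
      exact blockProduct_mul_scale_mem_span e hp hspan hu hi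
    have := hle hx
    simpa [scale, mul_assoc] using this

theorem leadingTerm_blockProduct_mem_adjoin {ι κ σ : Type*} [Fintype κ] (e : ι)
    (M : MonomialOrder (ι ⊕ σ))
    {m : MonomialOrder σ} {B : κ → Set (MvPolynomial σ ℂ)}
    (hC : ∃ c : ℂ, c ≠ 0 ∧ C c ∈ ⋃ i, B i)
    {w : κ → (σ →₀ ℕ) → ℕ} {p : κ → (σ →₀ ℕ) → MvPolynomial σ ℂ}
    (hp : ∀ i, ∀ a ∈ powDegrees m (B i), p i a ∈ B i ^ w i a)
    {u : ℕ × (κ → σ →₀ ℕ)} (hu : u ∈ blockIndices m B w) :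
    M.leadingTerm (blockProduct e p u) ∈
      Algebra.adjoin ℂ (M.leadingTerm '' scaledSet e (⋃ i, B i)) := by
  obtain ⟨hu1, hu2⟩ := hu
  -- The `l` powers of `s` left over by the weights are supplied by the generator `s * c` with `c` a
  -- nonzero constant.
  obtain ⟨l, hl⟩ := Nat.exists_eq_add_of_le hu2
  have hX : M.leadingTerm (scale e 1 (1 : MvPolynomial σ ℂ)) ∈
      Algebra.adjoin ℂ (M.leadingTerm '' scaledSet e (⋃ i, B i)) := by
    obtain ⟨c, hc, hcB⟩ := hC
    have h1 : M.leadingTerm (X (Sum.inl e) * rename Sum.inr (C c : MvPolynomial σ ℂ)) ∈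
        Algebra.adjoin ℂ (M.leadingTerm '' scaledSet e (⋃ i, B i)) :=
      Algebra.subset_adjoin ⟨_, ⟨_, hcB, rfl⟩, rfl⟩
    have h2 := Subalgebra.smul_mem _ h1 c⁻¹
    rw [rename_C, M.leadingTerm_mul, M.leadingTerm_C, smul_eq_C_mul, mul_left_comm, ← C_mul,
      inv_mul_cancel₀ hc, C_1, mul_one] at h2
    simpa [scale] using h2
  have hsplit : blockProduct e p u =
      (∏ i, scale e (w i (u.2 i)) (p i (u.2 i))) * scale e 1 1 ^ l := by
    rw [← scale_prod, blockProduct, hl]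
    simp only [scale, map_one, mul_one, pow_one, pow_add]
    ring
  rw [hsplit, ← leadingTermHom_apply, map_mul, map_pow, map_prod]
  refine mul_mem (prod_mem fun i _ => ?_) (pow_mem hX l)
  exact leadingTerm_mem_adjoin M
    (scale_mem_closure e (Set.pow_subset_pow_left (Set.subset_iUnion B i) (hp i _ (hu1 i))))

theorem injOn_degree_blockProduct {ι κ σ : Type*} [Fintype κ] (e : ι)
    (mt : MonomialOrder ι) {m : MonomialOrder σ} {B : κ → Set (MvPolynomial σ ℂ)}
    (hvars : ∀ i j, i ≠ j → ∀ p ∈ B i, ∀ q ∈ B j, Disjoint p.vars q.vars)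
    {w : κ → (σ →₀ ℕ) → ℕ} {p : κ → (σ →₀ ℕ) → MvPolynomial σ ℂ}
    (hp : ∀ i, ∀ a ∈ powDegrees m (B i), p i a ≠ 0 ∧ m.degree (p i a) = a) :
    Set.InjOn (fun u => (extendOrder mt m).degree (blockProduct e p u)) (blockIndices m B w) := by
  have hdeg : ∀ u ∈ blockIndices m B w, (extendOrder mt m).degree (blockProduct e p u) =
      Finsupp.sumElim (Finsupp.single e u.1) (∑ i, u.2 i) := by
    intro u hu
    have h0 : ∀ i ∈ Finset.univ, p i (u.2 i) ≠ 0 := fun i _ => (hp i _ (hu.1 i)).1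
    rw [blockProduct, degree_scale mt m e u.1 (Finset.prod_ne_zero_iff.mpr h0),
      MonomialOrder.degree_prod h0]
    congr 1
    exact Finset.sum_congr rfl fun i _ => (hp i _ (hu.1 i)).2
  intro u hu v hv huv
  dsimp only at huv
  rw [hdeg u hu, hdeg v hv] at huv
  refine Prod.ext ?_ (eq_of_sum_eq_of_mem_powDegrees hvars hu.1 hv.1 ?_)
  · simpa using DFunLike.congr_fun huv (Sum.inl e)
  · ext j
    simpa using DFunLike.congr_fun huv (Sum.inr j)

end Decoupling

theorem mainTheorem2 {n d : ℕ} (m : MonomialOrder (Fin n))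
    (ms : MonomialOrder (Fin d)) (mt : MonomialOrder (Fin 1))
    (A : Set (MvPolynomial (Fin n) ℂ)) (B : Fin d → Set (MvPolynomial (Fin n) ℂ))
    (hA : ∃ c : ℂ, c ≠ 0 ∧ MvPolynomial.C c ∈ A)
    (hAB : A = ⋃ i, B i)
    (hvars : ∀ i j, i ≠ j → ∀ p ∈ B i, ∀ q ∈ B j, Disjoint p.vars q.vars)
    (hB : ∀ i, ∃ c : ℂ, c ≠ 0 ∧ MvPolynomial.C c ∈ B i)
    (hK : ∀ i, Decoupling.IsKhovanskiiBasis (Decoupling.extendOrder ms m)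
      (Algebra.adjoin ℂ (Decoupling.scaledSet i (B i))) (Decoupling.scaledSet i (B i))) :
    Decoupling.IsKhovanskiiBasis (Decoupling.extendOrder mt m)
      (Algebra.adjoin ℂ (Decoupling.scaledSet (0 : Fin 1) A))
      (Decoupling.scaledSet (0 : Fin 1) A) := by
  subst hAB
  choose w p hp hw using fun i => Decoupling.exists_minimal_representatives m (B i)
  have hspan := fun i => Decoupling.span_pow_le_span_representatives m (hB i)
    (fun k f hf hf0 => Decoupling.exists_degree_eq_of_mem_span_pow (hK i) hf hf0) (hp i) (hw i)
  have hp1 := fun i a ha => (hp i a ha).1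
  refine ⟨Algebra.subset_adjoin,
    le_antisymm (Decoupling.adjoin_leadingTerm_le_initialAlgebra _ _) (Submodule.span_le.mpr ?_)⟩
  rintro _ ⟨f, hf, rfl⟩
  by_cases hf0 : f = 0
  · simp [hf0]
  obtain ⟨u, hu, hu0, hdeg⟩ := Decoupling.exists_degree_eq_of_mem_span _ _ _
    (Decoupling.injOn_degree_blockProduct 0 mt hvars fun i a ha => (hp i a ha).2)
    (Decoupling.adjoin_le_span_blockProduct 0 hp1 hw hspan hf) hf0
  rw [Decoupling.leadingTerm_eq_smul_of_degree_eq _ hu0 hdeg]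
  exact Subalgebra.smul_mem _
    (Decoupling.leadingTerm_blockProduct_mem_adjoin 0 _ hA hp1 hu) _
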